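/- Let $(W,S)$ be a Coxeter system. A \emph{reflection} of $W$ is an element of $W$ that is conjugate to an element of $S$, and a \emph{reflection subgroup} of $W$ is a subgroup of $W$ generated by a set of reflections. Let $J=\{s_1,\dots,s_n\}\subseteq S$ be a finite subset with $s_1,\dots,s_n$ pairwise distinct, listed in an arbitrary order, let $w=s_1s_2\cdots s_n$, and let $W_J=\langle J\rangle$. Then every reflection subgroup of $W$ that contains $w$ also contains $J$. In particular, $W_J$ is the unique minimal (with respect to inclusion) reflection subgroup of $W$ containing $w$. -/

import Mathlib

namespace CoxeterSystem

/-- A subgroup of `W` is a reflection subgroup if it is generated by some set of reflections,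
a reflection being a conjugate of a simple generator. -/
def IsReflectionSubgroup {B W : Type*} [Group W] {M : CoxeterMatrix B} (cs : CoxeterSystem M W)
    (G : Subgroup W) : Prop :=
  ∃ T : Set W, (∀ t ∈ T, cs.IsReflection t) ∧ G = Subgroup.closure T

end CoxeterSystem

namespace CoxeterSystem

section GroupLists

variable {W : Type*}

/-! Following Dyer, let the cocycle `invCocycle w t` record the parity of `t` as an inversion of
`w`. A reflection subgroup `G` is generated by its canonical generators, the involutions in `G`
whose only inversion in `G` is themselves. Deletion in these generators shows that each `g ≠ 1` in
`G` has an inversion `t ∈ G`. If `w = s₁⋯sₙ ∈ G` and `w ≠ 1`, exchange gives that `t * w ∈ G` is `w`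
with one letter removed. By induction the remaining letters lie in `G`, hence so does the removed
one. -/

/-- The Kronecker delta of `W` with values in `ZMod 2`. -/
noncomputable def delta (r t : W) : ZMod 2 := by
  classical exact if t = r then 1 else 0

theorem delta_self (r : W) : delta r r = 1 := by simp [delta]

theorem delta_of_ne {r t : W} (h : t ≠ r) : delta r t = 0 := by simp [delta, h]

theorem delta_congr {r t r' t' : W} (h : t = r ↔ t' = r') : delta r t = delta r' t' := by
  by_cases ht : t = r
  · simp [delta, ht, h.1 ht]
  · simp [delta, ht, mt h.2 ht]

variable [Group W]

/-- The exchange property for a product of elements on which a cocycle `N` with values in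
`W → ZMod 2` restricts to the Kronecker delta on a subgroup `G`. -/
theorem exists_exchange {N : W → W → ZMod 2} (h_one : ∀ t, N 1 t = 0)
    (h_mul : ∀ x y t, N (x * y) t = N x t + N y (x⁻¹ * t * x)) (G : Subgroup W) (L : List W)
    (hL : ∀ r ∈ L, r ∈ G ∧ r * r = 1 ∧ ∀ t ∈ G, N r t = delta r t) (t : W) (ht : t ∈ G)
    (hN : N L.prod t ≠ 0) :
    ∃ a s b, L = a ++ s :: b ∧ t * L.prod = (a ++ b).prod := by
  induction L generalizing t with
  | nil => simp [h_one] at hN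
  | cons r L ih =>
    obtain ⟨hrG, hrr, hrN⟩ := hL r (by simp)
    by_cases htr : t = r
    · exact ⟨[], r, L, rfl, by simp [htr, ← mul_assoc, hrr]⟩
    · rw [List.prod_cons, h_mul, hrN t ht, delta_of_ne htr, zero_add] at hN
      obtain ⟨a, s, b, hab, hprod⟩ := ih (fun x hx ↦ hL x (by simp [hx])) (r⁻¹ * t * r)
        (G.mul_mem (G.mul_mem (G.inv_mem hrG) ht) hrG) hN
      refine ⟨r :: a, s, b, by simp [hab], ?_⟩
      rw [List.cons_append, List.prod_cons, List.prod_cons, ← hprod]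
      group

/-- The deletion property: if the cocycle vanishes on a nonempty product, then two of the factors
can be omitted. -/
theorem exists_deletion {N : W → W → ZMod 2} (h_one : ∀ t, N 1 t = 0)
    (h_mul : ∀ x y t, N (x * y) t = N x t + N y (x⁻¹ * t * x)) (G : Subgroup W)
    (r : W) (L : List W)
    (hL : ∀ r' ∈ r :: L, r' ∈ G ∧ r' * r' = 1 ∧ ∀ t ∈ G, N r' t = delta r' t)
    (hN : ∀ t ∈ G, N (r :: L).prod t = 0) :
    ∃ a s b, L = a ++ s :: b ∧ (r :: L).prod = (a ++ b).prod := by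
  obtain ⟨hrG, -, hrN⟩ := hL r (by simp)
  refine exists_exchange h_one h_mul G L (fun x hx ↦ hL x (by simp [hx])) r hrG fun h ↦ ?_
  have := hN r hrG
  rw [List.prod_cons, h_mul, hrN r hrG, delta_self, inv_mul_cancel, one_mul, h] at this
  simp at this

end GroupLists

variable {B W : Type*} [Group W] {M : CoxeterMatrix B} (cs : CoxeterSystem M W)

/-! ### The inversion cocycle -/

/-- The affine action of a simple reflection on `ZMod 2`-valued functions on `W`. -/
noncomputable def simpleAffine (i : B) : Function.End (W → ZMod 2) :=
  fun f t ↦ f (cs.simple i * t * cs.simple i) + delta (cs.simple i) t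

theorem simpleAffine_mul_pow_apply (i j : B) (n : ℕ) (f : W → ZMod 2) (t : W) :
    ((cs.simpleAffine i * cs.simpleAffine j) ^ n) f t =
      f (((cs.simple i * cs.simple j) ^ n)⁻¹ * t * (cs.simple i * cs.simple j) ^ n) +
        ∑ k ∈ Finset.range (2 * n),
          delta ((cs.simple i * cs.simple j) ^ k * cs.simple i) t := by
  induction n generalizing t with
  | zero => simp; rfl
  | succ n ih =>
    set c := cs.simple i * cs.simple j with hc
    have hci : c⁻¹ = cs.simple j * cs.simple i := by simp [hc]
    have hcs : cs.simple i * c⁻¹ = c * cs.simple i := by rw [hci, hc, mul_assoc]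
    have step : ((cs.simpleAffine i * cs.simpleAffine j) ^ (n + 1)) f t =
        ((cs.simpleAffine i * cs.simpleAffine j) ^ n) f
          (cs.simple j * (cs.simple i * t * cs.simple i) * cs.simple j) +
          delta (cs.simple j) (cs.simple i * t * cs.simple i) + delta (cs.simple i) t := by
      rw [pow_succ']; rfl
    have hconj : cs.simple j * (cs.simple i * t * cs.simple i) * cs.simple j = c⁻¹ * t * c := by
      rw [hci, hc]; simp only [mul_assoc]
    rw [step, hconj, ih, show 2 * (n + 1) = 2 * n + 1 + 1 by ring, Finset.sum_range_succ',
      Finset.sum_range_succ']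
    have h₁ : delta (cs.simple j) (cs.simple i * t * cs.simple i) =
        delta (c ^ (0 + 1) * cs.simple i) t := by
      apply delta_congr
      rw [zero_add, pow_one, hc]
      constructor
      · intro h
        rw [← h]; simp [mul_assoc]
      · rintro rfl
        simp [mul_assoc]
    have h₂ : ∀ k, delta (c ^ k * cs.simple i) (c⁻¹ * t * c) =
        delta (c ^ (k + 1 + 1) * cs.simple i) t := by
      intro k
      apply delta_congr
      have : c ^ (k + 1 + 1) * cs.simple i = c * (c ^ k * cs.simple i) * c⁻¹ := by
        rw [pow_succ, pow_succ', mul_assoc, ← hcs]; simp only [mul_assoc]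
      rw [this, eq_mul_inv_iff_mul_eq, mul_assoc, inv_mul_eq_iff_eq_mul]
    have h₃ : (c ^ n)⁻¹ * (c⁻¹ * t * c) * c ^ n = (c ^ (n + 1))⁻¹ * t * c ^ (n + 1) := by
      rw [pow_succ']; group
    simp only [h₁, h₂, h₃, pow_zero, one_mul]
    ring

/-- For `n = M i j` the `2 * n` reflections in the sum repeat with period `n`, so they cancel mod 2.
-/
theorem isLiftable_simpleAffine : M.IsLiftable cs.simpleAffine := by
  intro i j
  funext f t
  rw [simpleAffine_mul_pow_apply, two_mul, Finset.sum_range_add]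
  simp only [pow_add, cs.simple_mul_simple_pow, one_mul, CharTwo.add_self_eq_zero]
  simp only [inv_one, one_mul, mul_one, add_zero]
  rfl

/-- The inversion cocycle of a Coxeter system: `cs.invCocycle w t` is the parity of the number of
occurrences of `t` in the left inversion sequence of any word for `w`. -/
noncomputable def invCocycle (w : W) : W → ZMod 2 :=
  cs.lift ⟨cs.simpleAffine, cs.isLiftable_simpleAffine⟩ w 0

theorem invCocycle_one (t : W) : cs.invCocycle 1 t = 0 := by
  simp only [invCocycle, map_one]; rfl

theorem lift_simpleAffine_apply (w : W) (f : W → ZMod 2) (t : W) :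
    cs.lift ⟨cs.simpleAffine, cs.isLiftable_simpleAffine⟩ w f t =
      cs.invCocycle w t + f (w⁻¹ * t * w) := by
  unfold invCocycle
  induction w using cs.simple_induction_left generalizing t with
  | one =>
    simp only [map_one, inv_one, one_mul, mul_one]
    exact (zero_add (f t)).symm
  | mul_simple_left w i ih =>
    have step : ∀ g, cs.lift ⟨cs.simpleAffine, cs.isLiftable_simpleAffine⟩ (cs.simple i * w) g t =
        cs.lift ⟨cs.simpleAffine, cs.isLiftable_simpleAffine⟩ w g
          (cs.simple i * t * cs.simple i) + delta (cs.simple i) t := by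
      intro g
      rw [map_mul, cs.lift_apply_simple]; rfl
    rw [step, step, ih]
    simp only [mul_inv_rev, inv_simple, mul_assoc]
    ring

theorem invCocycle_mul (x y t : W) :
    cs.invCocycle (x * y) t = cs.invCocycle x t + cs.invCocycle y (x⁻¹ * t * x) := by
  rw [← lift_simpleAffine_apply]
  simp only [invCocycle, map_mul]
  rfl

theorem invCocycle_simple (i : B) (t : W) :
    cs.invCocycle (cs.simple i) t = delta (cs.simple i) t := by
  simp [invCocycle, simpleAffine]

theorem invCocycle_inv (x t : W) : cs.invCocycle x⁻¹ t = cs.invCocycle x (x * t * x⁻¹) := by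
  have h := cs.invCocycle_mul x x⁻¹ (x * t * x⁻¹)
  rw [mul_inv_cancel, invCocycle_one] at h
  have h' : x⁻¹ * (x * t * x⁻¹) * x = t := by group
  rw [h'] at h
  exact (CharTwo.add_eq_zero.mp h.symm).symm

/-! ### Canonical generators of reflection subgroups -/

/-- The canonical generators of a reflection subgroup `G`. -/
def canonicalGenerators (G : Subgroup W) : Set W :=
  {r | r ∈ G ∧ r * r = 1 ∧ ∀ t ∈ G, cs.invCocycle r t = delta r t}

theorem conj_simple_mem_canonicalGenerators {G : Subgroup W} {x : W}
    (hx : ∀ t ∈ G, cs.invCocycle x t = 0) {i : B} (hr : x * cs.simple i * x⁻¹ ∈ G) :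
    x * cs.simple i * x⁻¹ ∈ cs.canonicalGenerators G := by
  refine ⟨hr, by simp, fun t ht ↦ ?_⟩
  have key : x * ((x * cs.simple i)⁻¹ * t * (x * cs.simple i)) * x⁻¹ =
      (x * cs.simple i * x⁻¹)⁻¹ * t * (x * cs.simple i * x⁻¹) := by
    simp [mul_assoc]
  rw [invCocycle_mul, invCocycle_mul, invCocycle_inv, invCocycle_simple, hx t ht, key,
    hx _ (G.mul_mem (G.mul_mem (G.inv_mem hr) ht) hr), zero_add, add_zero]
  apply delta_congr
  rw [eq_mul_inv_iff_mul_eq, mul_assoc, inv_mul_eq_iff_eq_mul]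

/-- Appending `s` to `x` adds only the inversion `x * s * x⁻¹`. If it lies in `G`, it is a canonical
generator and moves into `g`; otherwise `x * s` still has no inversion in `G`. -/
theorem exists_eq_mul_of_canonicalGenerators (G : Subgroup W) (w : W) :
    ∃ g ∈ Subgroup.closure (cs.canonicalGenerators G),
      ∃ x, (∀ t ∈ G, cs.invCocycle x t = 0) ∧ w = g * x := by
  induction w using cs.simple_induction_right with
  | one => exact ⟨1, one_mem _, 1, fun t _ ↦ cs.invCocycle_one t, by simp⟩
  | mul_simple_right w i ih =>
    obtain ⟨g, hg, x, hx, rfl⟩ := ih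
    by_cases hr : x * cs.simple i * x⁻¹ ∈ G
    · exact ⟨g * (x * cs.simple i * x⁻¹), mul_mem hg (Subgroup.subset_closure
        (cs.conj_simple_mem_canonicalGenerators hx hr)), x, hx, by group⟩
    · refine ⟨g, hg, x * cs.simple i, fun t ht ↦ ?_, by group⟩
      rw [invCocycle_mul, hx t ht, zero_add, invCocycle_simple]
      apply delta_of_ne
      intro h
      apply hr
      rw [← h]
      convert ht using 1
      group

theorem IsReflectionSubgroup.eq_closure_canonicalGenerators {cs : CoxeterSystem M W}
    {G : Subgroup W} (hG : cs.IsReflectionSubgroup G) :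
    G = Subgroup.closure (cs.canonicalGenerators G) := by
  have hle : Subgroup.closure (cs.canonicalGenerators G) ≤ G :=
    (Subgroup.closure_le _).2 fun r hr ↦ hr.1
  refine le_antisymm ?_ hle
  obtain ⟨T, hT, hGT⟩ := hG
  have hTG : T ⊆ G := hGT ▸ Subgroup.subset_closure
  conv_lhs => rw [hGT]
  rw [Subgroup.closure_le]
  intro t ht
  obtain ⟨u, i, hu⟩ := hT t ht
  -- Conjugating `t` by `g` reduces to `u = x`, where `x * s * x⁻¹` is canonical.
  obtain ⟨g, hg, x, hx, rfl⟩ := cs.exists_eq_mul_of_canonicalGenerators G u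
  have hconj : t = g * (x * cs.simple i * x⁻¹) * g⁻¹ := by rw [hu]; group
  have hr : x * cs.simple i * x⁻¹ ∈ G := by
    have : x * cs.simple i * x⁻¹ = g⁻¹ * t * g := by rw [hconj]; group
    rw [this]
    exact mul_mem (mul_mem (inv_mem (hle hg)) (hTG ht)) (hle hg)
  rw [hconj]
  exact mul_mem (mul_mem hg (Subgroup.subset_closure
    (cs.conj_simple_mem_canonicalGenerators hx hr))) (inv_mem hg)

theorem list_prod_eq_one_of_invCocycle_eq_zero {G : Subgroup W} (L : List W)
    (hL : ∀ r ∈ L, r ∈ cs.canonicalGenerators G) (hN : ∀ t ∈ G, cs.invCocycle L.prod t = 0) :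
    L.prod = 1 := by
  match L with
  | [] => rfl
  | r :: L =>
    obtain ⟨a, s, b, hab, hprod⟩ :=
      exists_deletion cs.invCocycle_one cs.invCocycle_mul G r L hL hN
    rw [hprod] at hN ⊢
    refine list_prod_eq_one_of_invCocycle_eq_zero (a ++ b) (fun x hx ↦ hL x ?_) hN
    rw [hab]
    simp only [List.mem_append, List.mem_cons] at hx ⊢
    tauto
  termination_by L.length
  decreasing_by simp [hab]

/-- A nontrivial element of a reflection subgroup has an inversion in that subgroup. -/
theorem IsReflectionSubgroup.exists_invCocycle_ne_zero {cs : CoxeterSystem M W}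
    {G : Subgroup W} (hG : cs.IsReflectionSubgroup G) {g : W} (hg : g ∈ G) (hne : g ≠ 1) :
    ∃ t ∈ G, cs.invCocycle g t ≠ 0 := by
  by_contra! h
  rw [hG.eq_closure_canonicalGenerators, ← Subgroup.mem_toSubmonoid,
    Subgroup.closure_toSubmonoid] at hg
  obtain ⟨L, hL, rfl⟩ := Submonoid.exists_list_of_mem_closure hg
  refine hne (cs.list_prod_eq_one_of_invCocycle_eq_zero L (fun r hr ↦ ?_) h)
  rcases hL r hr with h | h
  · exact h
  · have : r⁻¹ = r := by
      simpa using eq_inv_of_mul_eq_one_left h.2.1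
    rwa [Set.mem_inv, this] at h

/-! ### Products of distinct simple reflections -/

theorem mul_self_and_invCocycle_of_mem_range_simple (G : Subgroup W) {r : W}
    (hr : r ∈ Set.range cs.simple) :
    r * r = 1 ∧ ∀ t ∈ G, cs.invCocycle r t = delta r t := by
  obtain ⟨i, rfl⟩ := hr
  exact ⟨cs.simple_mul_simple_self i, fun t _ ↦ cs.invCocycle_simple i t⟩

/-- This covers `w = 1`, where there is no inversion to exchange. Deletion descends to the empty
word, leaving two letters with `r * s = 1`, so `r = s`. -/
theorem eq_nil_of_nodup_of_prod_eq_one (L : List W) (hL : ∀ r ∈ L, r ∈ Set.range cs.simple)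
    (hnd : L.Nodup) (hprod : L.prod = 1) : L = [] := by
  match L with
  | [] => rfl
  | r :: L =>
    exfalso
    obtain ⟨a, s, b, hab, hdel⟩ :=
      exists_deletion cs.invCocycle_one cs.invCocycle_mul ⊤ r L
        (fun x hx ↦ ⟨trivial, cs.mul_self_and_invCocycle_of_mem_range_simple ⊤ (hL x hx)⟩)
        (fun t _ ↦ by rw [hprod, invCocycle_one])
    subst hab
    have hsub : (a ++ b).Sublist (r :: (a ++ s :: b)) :=
      ((List.Sublist.refl a).append (List.sublist_cons_self s b)).trans (List.sublist_cons_self _ _)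
    have hnil := eq_nil_of_nodup_of_prod_eq_one (a ++ b) (fun x hx ↦ hL x (hsub.subset hx))
      (hnd.sublist hsub) (hdel ▸ hprod)
    obtain ⟨rfl, rfl⟩ := List.append_eq_nil_iff.1 hnil
    have hrs : r * s = 1 := by simpa using hprod
    have hss := (cs.mul_self_and_invCocycle_of_mem_range_simple ⊤ (hL s (by simp))).1
    have : r = s := mul_right_cancel (hrs.trans hss.symm)
    simp [this] at hnd
  termination_by L.length
  decreasing_by simp [*]

theorem IsReflectionSubgroup.mem_of_list_prod_mem {cs : CoxeterSystem M W} {G : Subgroup W}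
    (hG : cs.IsReflectionSubgroup G) (L : List W) (hL : ∀ r ∈ L, r ∈ Set.range cs.simple)
    (hnd : L.Nodup) (hprod : L.prod ∈ G) : ∀ r ∈ L, r ∈ G := by
  by_cases hne : L.prod = 1
  · simp [cs.eq_nil_of_nodup_of_prod_eq_one L hL hnd hne]
  obtain ⟨t, ht, hN⟩ := hG.exists_invCocycle_ne_zero hprod hne
  -- Exchange is applied over `⊤` because the letters are not yet known to lie in `G`; only `t` is.
  obtain ⟨a, s, b, rfl, hex⟩ := exists_exchange cs.invCocycle_one cs.invCocycle_mul ⊤ L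
    (fun x hx ↦ ⟨trivial, cs.mul_self_and_invCocycle_of_mem_range_simple ⊤ (hL x hx)⟩) t trivial hN
  have hsub : (a ++ b).Sublist (a ++ s :: b) :=
    (List.Sublist.refl a).append (List.sublist_cons_self s b)
  have ih := hG.mem_of_list_prod_mem (a ++ b) (fun x hx ↦ hL x (hsub.subset hx))
    (hnd.sublist hsub) (hex ▸ mul_mem ht hprod)
  have ha : a.prod ∈ G := list_prod_mem fun x hx ↦ ih x (by simp [hx])
  have hb : b.prod ∈ G := list_prod_mem fun x hx ↦ ih x (by simp [hx])
  have hs : s ∈ G := by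
    rw [List.prod_append, List.prod_cons] at hprod
    exact (G.mul_mem_cancel_right hb).1 ((G.mul_mem_cancel_left ha).1 hprod)
  intro r hr
  rcases List.mem_append.1 hr with h | h
  · exact ih r (by simp [h])
  · rcases List.mem_cons.1 h with rfl | h
    · exact hs
    · exact ih r (by simp [h])
  termination_by L.length
  decreasing_by simp [*]

end CoxeterSystem

/-- `S` is `Set.range cs.simple`, the list `l` is an arbitrary ordering of the elements of `J`
without repetition, `w` is `l.prod`, and `W_J` is `Subgroup.closure J`. -/
theorem mainTheorem12 {B W : Type*} [Group W] {M : CoxeterMatrix B} (cs : CoxeterSystem M W)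
    (J : Set W) (hJ : J ⊆ Set.range cs.simple)
    (l : List W) (hl : l.Nodup) (hlJ : ∀ x, x ∈ l ↔ x ∈ J) :
    (∀ G : Subgroup W, cs.IsReflectionSubgroup G → l.prod ∈ G → J ⊆ (G : Set W)) ∧
    (∀ H : Subgroup W,
      Minimal (fun G : Subgroup W => cs.IsReflectionSubgroup G ∧ l.prod ∈ G) H ↔
        H = Subgroup.closure J) := by
  have hmem : ∀ G : Subgroup W, cs.IsReflectionSubgroup G → l.prod ∈ G → J ⊆ (G : Set W) :=
    fun G hG hprod x hx ↦ hG.mem_of_list_prod_mem l (fun r hr ↦ hJ ((hlJ r).1 hr)) hl hprod x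
      ((hlJ x).2 hx)
  have hclosure : cs.IsReflectionSubgroup (Subgroup.closure J) ∧ l.prod ∈ Subgroup.closure J := by
    refine ⟨⟨J, fun t ht ↦ ?_, rfl⟩,
      list_prod_mem fun x hx ↦ Subgroup.subset_closure ((hlJ x).1 hx)⟩
    obtain ⟨i, rfl⟩ := hJ ht
    exact cs.isReflection_simple i
  have hle : ∀ G : Subgroup W, cs.IsReflectionSubgroup G ∧ l.prod ∈ G → Subgroup.closure J ≤ G :=
    fun G hG ↦ (Subgroup.closure_le G).2 (hmem G hG.1 hG.2)
  refine ⟨hmem, fun H ↦ ⟨fun hH ↦ ?_, ?_⟩⟩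
  · exact le_antisymm (hH.le_of_le hclosure (hle H hH.prop)) (hle H hH.prop)
  · rintro rfl
    exact ⟨hclosure, fun G hG _ ↦ hle G hG⟩
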